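/- **Setting.** Let $S$ be a countable (simple, undirected) graph, $\mathbf 0\in S$ a vertex, $\eta_0:S\to\mathbb N\cup\{0\}$ a deterministic initial occupation, and $P$ a transition kernel on $S$ that only allows nearest-neighbour moves: $P(x,y)=0$ unless $y=x$ or $y$ is adjacent to $x$. In the activated random walk (ARW) process with infinite sleep rate on $(S,\eta_0,P)$, initially there are $\eta_0(x)$ particles at each $x$. A particle is sleeping if and only if it is alone at its vertex, and is active otherwise. The particles carry independent rate one Poisson clocks. When the clock of a particle at $x$ rings, the particle jumps to a vertex chosen according to $P(x,\cdot)$, independently of everything else, if it is active immediately before the ring; otherwise it stays put. As a standing assumption, $\eta_0$ and $P$ generate a well-defined process whose local events can be finitely approximated. That is, there are finite sets $A_1\subseteq A_2\subseteq\cdots$ with union $S$ such that, for every finite $F\subseteq S$, every $T<\infty$ and every event $E$ measurable with respect to the numbers of particles at the vertices of $F$ during $[0,T]$, the probability of $E$ is the limit, as $m\to\infty$, of its probabilities for the ARW processes with initial occupation $\eta_0|_{A_m}$ (equal to $\eta_0$ on $A_m$ and $0$ elsewhere). Let $\mathcal C(\infty)$ be the random set of vertices that are occupied by some particle at some time $t\ge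 0$ (initial positions included), and let $\mathcal C_{\mathbf 0}(\infty)$ be the connected component of $\mathbf 0$ in the subgraph induced on $\mathcal C(\infty)$, empty if $\mathbf 0\notin\mathcal C(\infty)$. For $n\in\mathbb N$ let $W(n)$ be the maximum (supremum) of $\sum_{x\in A}\eta_0(x)$ over all connected vertex sets $A$ with $|A|=n$ and $\mathbf 0\in A$ (zero if there are none), and let $$\mathcal A=\mathcal A(S,\eta_0)=\sup\{n\in\mathbb N: W(n)\ge n\}\in\mathbb N\cup\{0,\infty\},\qquad \sup\emptyset=0 .$$ **Theorem.** Almost surely, $|\mathcal C_{\mathbf 0}(\infty)|\le\mathcal A(S,\eta_0)$. In particular, if $\mathcal A(S,\eta_0)<\infty$, then almost surely only finitely many distinct particles ever visit $\mathbf 0$. -/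

import Mathlib

open MeasureTheory ProbabilityTheory Filter Topology

namespace ARW

variable {V Ω : Type*}

/-! ### Labelled particles and their Poisson clocks

Particles carry labels in `V × ℕ`: the label `(v, i)` is the `i`-th particle starting at `v`.
An initial occupation `η` uses the labels `(v, i)` with `i < η v`. -/

/-- The particles present in the system with initial occupation `η`. -/
def particles (η : V → ℕ) : Set (V × ℕ) := {p | p.2 < η p.1}

/-- The time of the `n`-th ring of the clock of `p`, when `τ p k` is the waiting time between its
`k`-th and `(k+1)`-st ring; by convention the `0`-th ring is at time `0`. -/
noncomputable def ringTime (τ : V × ℕ → ℕ → ℝ) (p : V × ℕ) (n : ℕ) : ℝ :=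
  ∑ k ∈ Finset.range n, τ p k

/-- The driving randomness: every label has a rate one Poisson clock (i.i.d. exponential waiting
times of mean one), and `ξ p k x`, of law `P x`, is the target of the jump that `p` makes
at its `(k+1)`-st ring if it then is active at `x`. Everything is independent. -/
structure IsDriving [MeasurableSpace V] [MeasurableSpace Ω] (P : V → PMF V) (μ : Measure Ω)
    (τ : V × ℕ → ℕ → Ω → ℝ) (ξ : V × ℕ → ℕ → V → Ω → V) : Prop where
  law_wait : ∀ p k, HasLaw (τ p k) (expMeasure 1) μ
  law_jump : ∀ p k x, HasLaw (ξ p k x) (P x).toMeasure μ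
  indep_wait : iIndepFun (fun i : (V × ℕ) × ℕ => τ i.1 i.2) μ
  indep_jump : iIndepFun (fun i : (V × ℕ) × ℕ × V => ξ i.1 i.2.1 i.2.2) μ
  indep_wait_jump : IndepFun (fun ω (i : (V × ℕ) × ℕ) => τ i.1 i.2 ω)
    (fun ω (i : (V × ℕ) × ℕ × V) => ξ i.1 i.2.1 i.2.2 ω) μ

/-! ### The dynamics with infinite sleep rate -/

/-- With infinite sleep rate a particle is active if and only if it is not alone at its vertex.
Here: `p` is active immediately before time `t`. -/
def ActiveBefore (η : V → ℕ) (X : V × ℕ → ℝ → V) (p : V × ℕ) (t : ℝ) : Prop :=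
  ∃ q ∈ particles η, q ≠ p ∧ ∀ᶠ s in 𝓝[<] t, X q s = X p s

/-- The trajectories `X p t` (`p` a particle, `t ≥ 0`) follow the activated random walk dynamics
with infinite sleep rate from the initial occupation `η`, for the waiting times `τ` and jump
targets `ξ`: a particle moves only when its clock rings and it is active then. -/
structure IsPath (η : V → ℕ) (τ : V × ℕ → ℕ → ℝ) (ξ : V × ℕ → ℕ → V → V)
    (X : V × ℕ → ℝ → V) : Prop where
  start : ∀ p ∈ particles η, X p 0 = p.1
  const : ∀ p ∈ particles η, ∀ n, ∀ t ∈ Set.Ico (ringTime τ p n) (ringTime τ p (n + 1)),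
    X p t = X p (ringTime τ p n)
  jump : ∀ p ∈ particles η, ∀ n, ActiveBefore η X p (ringTime τ p (n + 1)) →
    X p (ringTime τ p (n + 1)) = ξ p n (X p (ringTime τ p n))
  sleep : ∀ p ∈ particles η, ∀ n, ¬ ActiveBefore η X p (ringTime τ p (n + 1)) →
    X p (ringTime τ p (n + 1)) = X p (ringTime τ p n)

/-- `X p t ω` is the position at time `t` of the particle `p` in an activated random walk process
with infinite sleep rate and initial occupation `η`, driven by `τ` and `ξ`. -/
structure IsProcess [MeasurableSpace V] [MeasurableSpace Ω] (μ : Measure Ω)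
    (τ : V × ℕ → ℕ → Ω → ℝ) (ξ : V × ℕ → ℕ → V → Ω → V) (η : V → ℕ)
    (X : V × ℕ → ℝ → Ω → V) : Prop where
  measurable : ∀ p ∈ particles η, ∀ t, 0 ≤ t → Measurable (X p t)
  path : ∀ᵐ ω ∂μ, IsPath η (fun p k => τ p k ω) (fun p k x => ξ p k x ω) (fun p t => X p t ω)

/-! ### Finite approximation -/

/-- The number of particles at `x` at time `t`. -/
noncomputable def occupation (η : V → ℕ) (X : V × ℕ → ℝ → V) (x : V) (t : ℝ) : ℕ∞ :=
  {p ∈ particles η | X p t = x}.encard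

/-- The history of the occupation numbers on `F` during `[0, T]`. -/
noncomputable def history (η : V → ℕ) (X : V × ℕ → ℝ → V) (F : Finset V) (T : ℝ) :
    F → Set.Icc (0 : ℝ) T → ℕ∞ :=
  fun x t => occupation η X x t

/-- Local events up to finite times can be finitely approximated: along some sequence of finite
sets `A m` increasing to `V`, the probability of every event that is measurable with respect to
the occupation numbers on a finite vertex set up to a finite time is the limit of its
probabilities for the (finite) processes with initial occupation `η` restricted to `A m`. -/
def FinitelyApproximable [MeasurableSpace V] [MeasurableSpace Ω] (μ : Measure Ω)
    (τ : V × ℕ → ℕ → Ω → ℝ) (ξ : V × ℕ → ℕ → V → Ω → V) (η : V → ℕ)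
    (X : V × ℕ → ℝ → Ω → V) : Prop :=
  ∃ (A : ℕ → Finset V) (Y : ℕ → V × ℕ → ℝ → Ω → V),
    Monotone A ∧ (∀ x, ∃ m, x ∈ A m) ∧
    (∀ m, IsProcess μ τ ξ ((A m : Set V).indicator η) (Y m)) ∧
    ∀ (F : Finset V) (T : ℝ) (E : Set (F → Set.Icc (0 : ℝ) T → ℕ∞)), MeasurableSet E →
      Tendsto
        (fun m => μ {ω | history ((A m : Set V).indicator η) (fun p t => Y m p t ω) F T ∈ E})
        atTop (𝓝 (μ {ω | history η (fun p t => X p t ω) F T ∈ E}))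

/-! ### The visited set and the density bound -/

/-- The set of vertices that are visited (at time `0` or later) by some particle. -/
def visited (η : V → ℕ) (X : V × ℕ → ℝ → V) : Set V :=
  {x | ∃ p ∈ particles η, ∃ t, 0 ≤ t ∧ X p t = x}

/-- The connected component of `o` in the subgraph induced on `C`; empty if `o ∉ C`. -/
def component (G : SimpleGraph V) (C : Set V) (o : V) : Set V :=
  {x | ∃ (ho : o ∈ C) (hx : x ∈ C), (G.induce C).Reachable ⟨o, ho⟩ ⟨x, hx⟩}

/-- `W(n)`: the maximal weight `∑ x ∈ A, η x` of a connected vertex set `A` of size `n`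
containing `o` (possibly infinite; zero if there is no such set). -/
noncomputable def maxWeight (G : SimpleGraph V) (η : V → ℕ) (o : V) (n : ℕ) : ℕ∞ :=
  ⨆ (A : Finset V) (_ : A.card = n ∧ o ∈ A ∧ (G.induce (A : Set V)).Connected),
    ((∑ x ∈ A, η x : ℕ) : ℕ∞)

/-- `sup {n : W(n) ≥ n}`, an element of `ℕ ∪ {∞}`. -/
noncomputable def criticalSize (G : SimpleGraph V) (η : V → ℕ) (o : V) : ℕ∞ :=
  ⨆ (n : ℕ) (_ : (n : ℕ∞) ≤ maxWeight G η o n), (n : ℕ∞)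

end ARW

/-! In a finite system an occupied vertex stays occupied: a lone particle sleeps, and since almost
surely no two clocks ring together, particles leave one at a time (`IsPath.occupied_of_le`).
Particles move along edges within the visited set, so none changes component
(`IsPath.mem_component_iff`). At a late time, any finite part of the component `C` of `o` is thus
fully occupied, by distinct particles that started in `C`. Hence `C` is finite, its size is at most
its initial weight, and it competes in the supremum defining `criticalSize`
(`IsPath.encard_component_le`).

For the infinite system, let `F` be a finite set whose own component of `o` is too large. Covering
`F` by a given time is a local event, null in every finite system, hence null in the limit. There
are countably many `F`, and they detect any oversized component. -/

namespace ARW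

/-! ### Regular realisations of the driving randomness -/

/-- The waiting times are positive with infinite sum, no two clocks ring simultaneously, and jumps
follow the edges of `G`. -/
structure IsRegular {V : Type*} (G : SimpleGraph V) (τ : V × ℕ → ℕ → ℝ)
    (ξ : V × ℕ → ℕ → V → V) : Prop where
  pos : ∀ p n, 0 < τ p n
  tendsto_ringTime : ∀ p, Tendsto (ringTime τ p) atTop atTop
  ringTime_ne : ∀ p q, p ≠ q → ∀ m n, ringTime τ p (m + 1) ≠ ringTime τ q (n + 1)
  jump : ∀ p n x, x = ξ p n x ∨ G.Adj x (ξ p n x)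

section Deterministic

variable {V : Type*} {G : SimpleGraph V} {τ : V × ℕ → ℕ → ℝ} {ξ : V × ℕ → ℕ → V → V}
  {η : V → ℕ} {X : V × ℕ → ℝ → V}

@[simp] lemma ringTime_zero (τ : V × ℕ → ℕ → ℝ) (p : V × ℕ) : ringTime τ p 0 = 0 := by
  simp [ringTime]

lemma IsRegular.strictMono (h : IsRegular G τ ξ) (p : V × ℕ) : StrictMono (ringTime τ p) :=
  strictMono_nat_of_lt_succ fun n => by
    simpa [ringTime, Finset.sum_range_succ] using h.pos p n

lemma IsRegular.exists_mem_Ico (h : IsRegular G τ ξ) (p : V × ℕ) {t : ℝ} (ht : 0 ≤ t) :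
    ∃ n, t ∈ Set.Ico (ringTime τ p n) (ringTime τ p (n + 1)) := by
  classical
  have hex : ∃ n, t < ringTime τ p n := ((h.tendsto_ringTime p).eventually_gt_atTop t).exists
  obtain ⟨n, hn⟩ : ∃ n, Nat.find hex = n + 1 := Nat.exists_eq_succ_of_ne_zero fun h0 => by
    have := Nat.find_spec hex
    rw [h0, ringTime_zero] at this
    linarith
  exact ⟨n, not_lt.1 (Nat.find_min hex (by omega)), hn ▸ Nat.find_spec hex⟩

/-- Closing the interval on the right gives access to the position just before `t`, even when the
clock rings at `t`. -/
lemma IsRegular.exists_mem_Ioc (h : IsRegular G τ ξ) (p : V × ℕ) {t : ℝ} (ht : 0 < t) :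
    ∃ n, t ∈ Set.Ioc (ringTime τ p n) (ringTime τ p (n + 1)) := by
  obtain ⟨n, h1, h2⟩ := h.exists_mem_Ico p ht.le
  rcases h1.lt_or_eq with h1 | h1
  · exact ⟨n, h1, h2.le⟩
  · cases n with
    | zero => simp at h1; linarith
    | succ n => exact ⟨n, h1 ▸ h.strictMono p n.lt_succ_self, h1.ge⟩

/-- Trajectories are right-continuous. -/
lemma IsPath.eventually_right (hX : IsPath η τ ξ X) (h : IsRegular G τ ξ) {p : V × ℕ}
    (hp : p ∈ particles η) {t : ℝ} (ht : 0 ≤ t) : ∀ᶠ s in 𝓝[>] t, X p s = X p t := by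
  obtain ⟨n, h1, h2⟩ := h.exists_mem_Ico p ht
  filter_upwards [Ioo_mem_nhdsGT h2] with s hs
  rw [hX.const p hp n s ⟨h1.trans hs.1.le, hs.2⟩, hX.const p hp n t ⟨h1, h2⟩]

/-- A particle moves only to the vertex itself or a neighbour at each ring. -/
lemma IsPath.adj_ringTime (hX : IsPath η τ ξ X) (h : IsRegular G τ ξ) {p : V × ℕ}
    (hp : p ∈ particles η) (n : ℕ) :
    X p (ringTime τ p n) = X p (ringTime τ p (n + 1)) ∨
      G.Adj (X p (ringTime τ p n)) (X p (ringTime τ p (n + 1))) := by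
  by_cases ha : ActiveBefore η X p (ringTime τ p (n + 1))
  · rw [hX.jump p hp n ha]
    exact h.jump _ _ _
  · exact Or.inl (hX.sleep p hp n ha).symm

lemma mem_visited {p : V × ℕ} (hp : p ∈ particles η) {t : ℝ} (ht : 0 ≤ t) :
    X p t ∈ visited η X := ⟨p, hp, t, ht, rfl⟩

lemma IsRegular.ringTime_nonneg (h : IsRegular G τ ξ) (p : V × ℕ) (n : ℕ) :
    0 ≤ ringTime τ p n := by
  simpa using (h.strictMono p).monotone n.zero_le

/-! ### Components of the visited set -/

lemma component_mono {C D : Set V} (h : C ⊆ D) (o : V) : component G C o ⊆ component G D o := by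
  rintro x ⟨ho, hx, hr⟩
  exact ⟨h ho, h hx, hr.map (SimpleGraph.induceHomOfLE G h).toHom⟩

lemma component_subset (C : Set V) (o : V) : component G C o ⊆ C := fun _ hx => hx.2.1

/-- Equal or adjacent vertices of `C` belong to the same component. -/
lemma mem_component_iff_of_adj {C : Set V} {o x y : V} (hx : x ∈ C) (hy : y ∈ C)
    (h : x = y ∨ G.Adj x y) : x ∈ component G C o ↔ y ∈ component G C o := by
  rcases h with rfl | h
  · rfl
  have ha : (G.induce C).Adj ⟨x, hx⟩ ⟨y, hy⟩ := h
  constructor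
  · rintro ⟨ho, _, hr⟩
    exact ⟨ho, hy, hr.trans ha.reachable⟩
  · rintro ⟨ho, _, hr⟩
    exact ⟨ho, hx, hr.trans ha.symm.reachable⟩

/-- A particle never leaves the component of the visited set in which it starts. -/
lemma IsPath.mem_component_iff (hX : IsPath η τ ξ X) (h : IsRegular G τ ξ) {p : V × ℕ}
    (hp : p ∈ particles η) {t : ℝ} (ht : 0 ≤ t) (o : V) :
    X p t ∈ component G (visited η X) o ↔ p.1 ∈ component G (visited η X) o := by
  obtain ⟨n, hn⟩ := h.exists_mem_Ico p ht
  rw [hX.const p hp n t hn]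
  clear hn
  induction n with
  | zero => rw [ringTime_zero, hX.start p hp]
  | succ n ih =>
    rw [← ih]
    exact (mem_component_iff_of_adj (mem_visited hp (h.ringTime_nonneg p n))
      (mem_visited hp (h.ringTime_nonneg p (n + 1))) (hX.adj_ringTime h hp n)).symm

/-! ### Persistence of occupation in finite systems -/

/-- A vertex occupied at times accumulating at `t` from the left is occupied at time `t`. -/
lemma IsPath.occupied_of_frequently_left (hX : IsPath η τ ξ X) (h : IsRegular G τ ξ)
    (hfin : (particles η).Finite) {t : ℝ} (ht : 0 < t) {x : V}
    (hf : ∃ᶠ s in 𝓝[<] t, ∃ p ∈ particles η, X p s = x) : ∃ p ∈ particles η, X p t = x := by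
  choose n hn using fun p => h.exists_mem_Ioc p ht
  have hL : ∀ p ∈ particles η, ∀ᶠ s in 𝓝[<] t, X p s = X p (ringTime τ p (n p)) := by
    intro p hp
    filter_upwards [Ioo_mem_nhdsLT (hn p).1] with s hs
    exact hX.const p hp _ s ⟨hs.1.le, hs.2.trans_le (hn p).2⟩
  have hR : ∀ p ∈ particles η, t ≠ ringTime τ p (n p + 1) →
      X p t = X p (ringTime τ p (n p)) := fun p hp hne =>
    hX.const p hp _ t ⟨(hn p).1.le, lt_of_le_of_ne (hn p).2 hne⟩
  obtain ⟨s, ⟨q, hq, hqs⟩, hs⟩ := (hf.and_eventually ((eventually_all_finite hfin).2 hL)).exists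
  rw [hs q hq] at hqs
  -- Only a ring of `q` at `t` can move it. If `q` is then active, its companion `q'` cannot ring at
  -- the same time and keeps `x` occupied.
  by_cases hne : t = ringTime τ q (n q + 1)
  · by_cases ha : ActiveBefore η X q (ringTime τ q (n q + 1))
    · obtain ⟨q', hq', hqq, he⟩ := ha
      rw [← hne] at he
      obtain ⟨r, hr, hr', hr''⟩ := (he.and ((hL q hq).and (hL q' hq'))).exists
      refine ⟨q', hq', ?_⟩
      rw [hR q' hq' (fun h' => h.ringTime_ne q' q hqq _ _ (h'.symm.trans hne)), ← hr'', hr, hr',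
        hqs]
    · refine ⟨q, hq, ?_⟩
      rw [hne, hX.sleep q hq _ ha, hqs]
  · exact ⟨q, hq, (hR q hq hne).trans hqs⟩

/-- In a finite system, an occupied vertex remains occupied for ever. -/
lemma IsPath.occupied_of_le (hX : IsPath η τ ξ X) (h : IsRegular G τ ξ)
    (hfin : (particles η).Finite) {s t : ℝ} (hs : 0 ≤ s) (hst : s ≤ t) {x : V}
    (hx : ∃ p ∈ particles η, X p s = x) : ∃ p ∈ particles η, X p t = x := by
  have hright : ∀ u, 0 ≤ u → ∀ᶠ r in 𝓝[>] u, ∀ p ∈ particles η, X p r = X p u := fun u hu =>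
    (eventually_all_finite hfin).2 fun p hp => hX.eventually_right h hp hu
  let S : Set ℝ := {u | ∃ p ∈ particles η, X p u = x}
  -- Continuous induction on `[s, t]`: the occupied times form a closed set that can always be
  -- prolonged to the right.
  have hclosed : IsClosed (S ∩ Set.Icc s t) := by
    rw [isClosed_iff_frequently]
    intro u hu
    have hmem : u ∈ Set.Icc s t :=
      isClosed_Icc.mem_of_frequently_of_tendsto (hu.mono fun _ h => h.2) tendsto_id
    refine ⟨?_, hmem⟩
    have hu0 : 0 ≤ u := hs.trans hmem.1
    rw [← nhdsNE_sup_pure, ← nhdsLT_sup_nhdsGT, frequently_sup, frequently_sup] at hu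
    rcases hu with (hu | hu) | hu
    · refine hX.occupied_of_frequently_left h hfin (hu0.lt_of_ne ?_) (hu.mono fun _ h => h.1)
      rintro rfl
      obtain ⟨r, hr, hr'⟩ := (hu.and_eventually self_mem_nhdsWithin).exists
      exact absurd (hs.trans hr.2.1) (not_le.2 hr')
    · obtain ⟨r, ⟨⟨p, hp, hpr⟩, -⟩, hr⟩ := (hu.and_eventually (hright u hu0)).exists
      exact ⟨p, hp, (hr p hp).symm.trans hpr⟩
    · exact (frequently_pure.1 hu).1
  refine hclosed.mem_of_ge_of_forall_exists_gt hx hst ?_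
  rintro u ⟨⟨p, hp, hpu⟩, hu⟩
  obtain ⟨r, hr, hr'⟩ := ((hright u (hs.trans hu.1)).and (Ioc_mem_nhdsGT hu.2)).exists
  exact ⟨r, ⟨p, hp, (hr p hp).trans hpu⟩, hr'⟩

/-- A visited vertex is occupied at some rational time. -/
lemma IsPath.exists_rat_occupied (hX : IsPath η τ ξ X) (h : IsRegular G τ ξ) {x : V}
    (hx : x ∈ visited η X) : ∃ r : ℚ, 0 ≤ (r : ℝ) ∧ ∃ p ∈ particles η, X p r = x := by
  obtain ⟨p, hp, t, ht, rfl⟩ := hx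
  obtain ⟨u, hu, hsub⟩ := mem_nhdsGT_iff_exists_Ioo_subset.1 (hX.eventually_right h hp ht)
  obtain ⟨r, hr⟩ := exists_rat_btwn (Set.mem_Ioi.1 hu)
  exact ⟨r, ht.trans hr.1.le, p, hp, hsub hr⟩

/-! ### Counting particles against vertices -/

lemma mem_particles_finite_of_finite (η : V → ℕ) {C : Set V} (hC : C.Finite) :
    {p ∈ particles η | p.1 ∈ C}.Finite := by
  refine (hC.biUnion fun x _ => (Set.finite_Iio (η x)).image (Prod.mk x)).subset ?_
  rintro ⟨x, i⟩ ⟨hi, hx⟩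
  exact Set.mem_biUnion hx ⟨i, hi, rfl⟩

lemma encard_particles_le (η : V → ℕ) (C : Finset V) :
    {p ∈ particles η | p.1 ∈ C}.encard ≤ (∑ x ∈ C, η x : ℕ) := by
  have : {p ∈ particles η | p.1 ∈ C}
      ⊆ ((C.sigma fun x => Finset.range (η x)).map
        (Equiv.sigmaEquivProd V ℕ).toEmbedding : Finset (V × ℕ)) := by
    rintro ⟨x, i⟩ ⟨hi, hx⟩
    simpa [particles] using And.intro hx hi
  refine (Set.encard_le_encard this).trans ?_
  rw [Set.encard_coe_eq_coe_finsetCard, Finset.card_map, Finset.card_sigma]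
  simp

/-- Every vertex of a walk in `C` from `o` is itself in the component, so the walk survives in the
smaller induced graph. -/
lemma component_reachable {C : Set V} {o x : V} (hx : x ∈ component G C o) :
    ∃ (ho : o ∈ component G C o),
      (G.induce (component G C o)).Reachable ⟨o, ho⟩ ⟨x, hx⟩ := by
  obtain ⟨hoC, hxC, ⟨w⟩⟩ := id hx
  have ho : o ∈ component G C o := ⟨hoC, hoC, .rfl⟩
  refine ⟨ho, ?_⟩
  suffices H : ∀ (a b : C) (_ : (G.induce C).Walk a b) (ha : (a : V) ∈ component G C o)
      (hb : (b : V) ∈ component G C o),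
      (G.induce (component G C o)).Reachable ⟨a, ha⟩ ⟨b, hb⟩ from H _ _ w ho hx
  intro a b w
  induction w with
  | nil => exact fun _ _ => .rfl
  | @cons a c b hac w ih =>
    intro ha hb
    have hc : (c : V) ∈ component G C o :=
      (mem_component_iff_of_adj a.2 c.2 (Or.inr hac)).1 ha
    have hadj : (G.induce (component G C o)).Adj ⟨a, ha⟩ ⟨c, hc⟩ := hac
    exact hadj.reachable.trans (ih hc hb)

lemma connected_induce_component {C : Set V} {o : V} (ho : o ∈ C) :
    (G.induce (component G C o)).Connected := by
  rw [SimpleGraph.connected_iff_exists_forall_reachable]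
  exact ⟨⟨o, ho, ho, .rfl⟩, fun x => (component_reachable x.2).2⟩

/-- A finite component of weight at least its size is at most of critical size. -/
lemma encard_component_le_criticalSize {C : Set V} {o : V}
    (hfin : (component G C o).Finite)
    (hle : (component G C o).encard ≤ (∑ x ∈ hfin.toFinset, η x : ℕ)) :
    (component G C o).encard ≤ criticalSize G η o := by
  by_cases ho : o ∈ C
  · have hcard : (component G C o).encard = (hfin.toFinset.card : ℕ∞) :=
      hfin.encard_eq_coe_toFinset_card
    rw [hcard] at hle ⊢
    refine le_iSup₂_of_le hfin.toFinset.card ?_ le_rfl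
    refine hle.trans (le_iSup₂_of_le (f := fun (A : Finset V) (_ : A.card = _ ∧ o ∈ A ∧
      (G.induce (A : Set V)).Connected) => ((∑ x ∈ A, η x : ℕ) : ℕ∞)) hfin.toFinset
      ⟨rfl, ?_, ?_⟩ le_rfl)
    · rw [Set.Finite.mem_toFinset]
      exact ⟨ho, ho, .rfl⟩
    · rw [Set.Finite.coe_toFinset]
      exact connected_induce_component ho
  · have : component G C o = ∅ := Set.eq_empty_of_forall_notMem fun x hx => ho hx.1
    simp [this]

lemma criticalSize_mono {η' : V → ℕ} (h : ∀ x, η x ≤ η' x) (o : V) :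
    criticalSize G η o ≤ criticalSize G η' o := by
  have hW : ∀ n, maxWeight G η o n ≤ maxWeight G η' o n := fun n =>
    iSup₂_mono fun A _ => Nat.cast_le.2 (Finset.sum_le_sum fun x _ => h x)
  exact iSup₂_le fun n hn => le_iSup₂_of_le n (hn.trans (hW n)) le_rfl

/-- The bound for finite systems. -/
lemma IsPath.encard_component_le (hX : IsPath η τ ξ X) (h : IsRegular G τ ξ)
    (hfin : (particles η).Finite) (o : V) :
    (component G (visited η X) o).encard ≤ criticalSize G η o := by
  classical
  set C := component G (visited η X) o with hC
  have key : ∀ K : Finset V, (K : Set V) ⊆ C →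
      (K : Set V).encard ≤ {p ∈ particles η | p.1 ∈ C}.encard := by
    intro K hK
    have hK' : ∀ x ∈ K, ∃ t, 0 ≤ t ∧ ∃ p ∈ particles η, X p t = x := fun x hx => by
      obtain ⟨p, hp, t, ht, hpt⟩ := component_subset _ _ (hK hx)
      exact ⟨t, ht, p, hp, hpt⟩
    choose! t ht hocc using hK'
    obtain ⟨T, hT⟩ := (K.image t).bddAbove
    -- By persistence all of `K` is occupied at one common time; `max` with `0` keeps that time
    -- nonnegative when `K` is empty.
    have hsub : (K : Set V) ⊆ (fun p => X p (max T 0)) '' {p ∈ particles η | p.1 ∈ C} := by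
      intro x hx
      obtain ⟨p, hp, hpx⟩ := hX.occupied_of_le h hfin (ht x hx)
        ((hT (Finset.mem_coe.2 (Finset.mem_image_of_mem t hx))).trans (le_max_left T 0))
        (hocc x hx)
      refine ⟨p, ⟨hp, ?_⟩, hpx⟩
      rw [hC, ← hX.mem_component_iff h hp (le_max_right T 0), hpx]
      exact hK hx
    exact (Set.encard_le_encard hsub).trans (Set.encard_image_le _ _)
  have hCfin : C.Finite := by
    by_contra hinf
    have hsub : {p ∈ particles η | p.1 ∈ C}.Finite := hfin.subset fun p hp => hp.1
    obtain ⟨K, hK, hcard⟩ := Set.Infinite.exists_subset_card_eq hinf (hsub.toFinset.card + 1)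
    have := key K hK
    rw [hsub.encard_eq_coe_toFinset_card, Set.encard_coe_eq_coe_finsetCard, hcard,
      Nat.cast_le] at this
    omega
  refine encard_component_le_criticalSize hCfin ?_
  have := key hCfin.toFinset (by simp)
  rw [hCfin.coe_toFinset] at this
  refine this.trans ?_
  simpa using encard_particles_le η hCfin.toFinset

/-! ### Exhaustion by finite sets -/

/-- Components are exhausted by the components of finite subsets. -/
lemma exists_finset_subset_component {C : Set V} {o : V} (K : Finset V)
    (hK : (K : Set V) ⊆ component G C o) :
    ∃ F : Finset V, (F : Set V) ⊆ C ∧ (K : Set V) ⊆ component G (F : Set V) o := by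
  classical
  induction K using Finset.induction_on with
  | empty => exact ⟨∅, by simp, by simp⟩
  | insert x K hxK ih =>
    rw [Finset.coe_insert, Set.insert_subset_iff] at hK
    obtain ⟨F, hFC, hKF⟩ := ih hK.2
    obtain ⟨ho, hx, ⟨w⟩⟩ := hK.1
    -- The vertices of one walk from `o` to `x` suffice to connect `x`.
    let S : Finset V := w.support.toFinset.image Subtype.val
    have hSw : ∀ y ∈ w.support, (y : V) ∈ (S : Set V) := fun y hy => by
      simpa [S] using hy
    have hxS : x ∈ component G (S : Set V) o := by
      have H : ∀ (a b : C) (v : (G.induce C).Walk a b)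
          (hv : ∀ y ∈ v.support, (y : V) ∈ (S : Set V)),
          (G.induce (S : Set V)).Reachable ⟨a, hv a v.start_mem_support⟩
            ⟨b, hv b v.end_mem_support⟩ := by
        intro a b v
        induction v with
        | nil => exact fun _ => .rfl
        | @cons a c b hac v ih =>
          intro hv
          have hadj : (G.induce (S : Set V)).Adj ⟨a, hv a (by simp)⟩
            ⟨c, hv c (by simp)⟩ := hac
          exact hadj.reachable.trans (ih fun y hy => hv y (by simp [hy]))
      exact ⟨_, _, H _ _ w hSw⟩
    refine ⟨F ∪ S, ?_, ?_⟩
    · rw [Finset.coe_union, Set.union_subset_iff]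
      refine ⟨hFC, ?_⟩
      intro y hy
      obtain ⟨z, -, rfl⟩ := Finset.mem_image.1 (Finset.mem_coe.1 hy)
      exact z.2
    · rw [Finset.coe_insert, Set.insert_subset_iff, Finset.coe_union]
      exact ⟨component_mono Set.subset_union_right o hxS,
        hKF.trans (component_mono Set.subset_union_left o)⟩

lemma encard_component_le_of_forall_finset {C : Set V} {o : V} {k : ℕ∞}
    (h : ∀ F : Finset V, (F : Set V) ⊆ C → (component G (F : Set V) o).encard ≤ k) :
    (component G C o).encard ≤ k := by
  by_contra! hlt
  obtain ⟨K', hK', hcard⟩ := Set.exists_subset_encard_eq (Order.add_one_le_of_lt hlt)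
  have hk : k ≠ ⊤ := ne_top_of_lt hlt
  have hfin : K'.Finite := Set.encard_ne_top_iff.1 (by
    rw [hcard]; simp [hk])
  obtain ⟨F, hF, hKF⟩ := exists_finset_subset_component hfin.toFinset (by simpa using hK')
  have := (Set.encard_le_encard hKF).trans (h F hF)
  rw [hfin.coe_toFinset, hcard] at this
  exact absurd ((ENat.lt_add_one_iff hk).2 le_rfl) (not_lt.2 this)

end Deterministic

/-! ### Almost sure regularity -/

section Probability

variable {V Ω : Type*} [MeasurableSpace Ω] {μ : Measure Ω}

lemma expMeasure_one_singleton (x : ℝ) : expMeasure 1 {x} = 0 :=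
  withDensity_absolutelyContinuous _ _ Real.volume_singleton

lemma expMeasure_one_Iic_zero : expMeasure 1 (Set.Iic 0) = 0 := by
  have := isProbabilityMeasure_expMeasure one_pos
  rw [← ofReal_cdf, cdf_expMeasure_eq one_pos]
  simp

lemma ae_pos_of_hasLaw_exp {Y : Ω → ℝ} (hY : HasLaw Y (expMeasure 1) μ) : ∀ᵐ ω ∂μ, 0 < Y ω := by
  rw [ae_iff]
  simp only [not_lt]
  rw [hY.measure_eq measurableSet_Iic]
  exact expMeasure_one_Iic_zero

/-- Sums of independent exponential waiting times diverge almost surely. -/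
lemma ae_tendsto_sum_exp [IsProbabilityMeasure μ] {Y : ℕ → Ω → ℝ}
    (hlaw : ∀ k, HasLaw (Y k) (expMeasure 1) μ) (hindep : iIndepFun Y μ) :
    ∀ᵐ ω ∂μ, Tendsto (fun n => ∑ k ∈ Finset.range n, Y k ω) atTop atTop := by
  -- Truncation makes integrability immediate; divergence needs only a positive mean.
  let g : ℝ → ℝ := fun x => min |x| 1
  have hg : Measurable g := by fun_prop
  have hg0 : ∀ x, 0 ≤ g x := fun x => le_min (abs_nonneg x) zero_le_one
  have hint : Integrable (g ∘ Y 0) μ :=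
    Integrable.of_bound (hg.comp_aemeasurable (hlaw 0).aemeasurable).aestronglyMeasurable 1
      (ae_of_all _ fun ω => by
        simp only [Function.comp_apply, Real.norm_eq_abs, abs_of_nonneg (hg0 _)]
        exact min_le_right _ _)
  have hident : ∀ i, IdentDistrib (g ∘ Y i) (g ∘ Y 0) μ μ := fun i =>
    IdentDistrib.comp ⟨(hlaw i).aemeasurable, (hlaw 0).aemeasurable,
      (hlaw i).map_eq.trans (hlaw 0).map_eq.symm⟩ hg
  have hslln := strong_law_ae_real (fun i => g ∘ Y i) hint
    (fun i j hij => (hindep.indepFun hij).comp hg hg) hident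
  have hmean : 0 < μ[g ∘ Y 0] := by
    refine lt_of_le_of_ne (integral_nonneg fun ω => hg0 _) fun h0 => ?_
    have hae := (integral_eq_zero_iff_of_nonneg (fun ω => hg0 _) hint).1 h0.symm
    obtain ⟨ω, h1, h2⟩ := (hae.and (ae_pos_of_hasLaw_exp (hlaw 0))).exists
    have : 0 < g (Y 0 ω) := lt_min (abs_pos.2 h2.ne') one_pos
    exact this.ne' h1
  filter_upwards [hslln, ae_all_iff.2 fun k => ae_pos_of_hasLaw_exp (hlaw k)] with ω hω hpos
  have h1 : Tendsto (fun n : ℕ => (∑ i ∈ Finset.range n, (g ∘ Y i) ω) / n * n) atTop atTop :=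
    hω.pos_mul_atTop hmean tendsto_natCast_atTop_atTop
  refine tendsto_atTop_mono (fun n => ?_) h1
  rcases Nat.eq_zero_or_pos n with rfl | hn
  · simp
  · rw [div_mul_cancel₀ _ (by positivity)]
    exact Finset.sum_le_sum fun i _ => (min_le_left _ _).trans (abs_of_pos (hpos i)).le

/-- A random variable without atoms almost surely differs from any independent one. -/
lemma ae_ne_of_indepFun [IsProbabilityMeasure μ] {Y Z : Ω → ℝ} (hY : AEMeasurable Y μ)
    (hZ : AEMeasurable Z μ) (hindep : IndepFun Z Y μ) (hatom : ∀ x, μ.map Y {x} = 0) :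
    ∀ᵐ ω ∂μ, Z ω ≠ Y ω := by
  have hdiag : MeasurableSet {z : ℝ × ℝ | z.1 = z.2} :=
    measurableSet_eq_fun measurable_fst measurable_snd
  have hmap := (indepFun_iff_map_prod_eq_prod_map_map hZ hY).1 hindep
  have := Measure.isProbabilityMeasure_map hY
  have h0 : μ.map (fun ω => (Z ω, Y ω)) {z : ℝ × ℝ | z.1 = z.2} = 0 := by
    rw [hmap, Measure.measure_prod_null hdiag]
    refine ae_of_all _ fun x => ?_
    have : Prod.mk x ⁻¹' {z : ℝ × ℝ | z.1 = z.2} = {x} := by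
      ext y; simp [eq_comm]
    exact (congrArg (μ.map Y) this).trans (hatom x)
  rw [Measure.map_apply_of_aemeasurable (hZ.prodMk hY) hdiag] at h0
  rw [ae_iff]
  simpa using h0

/-- A coincidence would force the atomless `τ p 0` to equal a combination of the other waiting
times, which is independent of it. -/
lemma ae_ringTime_ne [IsProbabilityMeasure μ] {τ : V × ℕ → ℕ → Ω → ℝ}
    (hlaw : ∀ p k, HasLaw (τ p k) (expMeasure 1) μ)
    (hindep : iIndepFun (fun i : (V × ℕ) × ℕ => τ i.1 i.2) μ) {p q : V × ℕ} (hpq : p ≠ q)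
    (m n : ℕ) :
    ∀ᵐ ω ∂μ, ringTime (fun p k => τ p k ω) p (m + 1) ≠ ringTime (fun p k => τ p k ω) q n := by
  classical
  let c : (V × ℕ) × ℕ → ℝ := fun i => if i.1 = q then 1 else -1
  let f : (V × ℕ) × ℕ → Ω → ℝ := fun i ω => c i * τ i.1 i.2 ω
  have hc : c (p, 0) = -1 := if_neg hpq
  have hf : iIndepFun f μ := hindep.comp (fun i x => c i * x) fun i => by fun_prop
  have hfm : ∀ i, AEMeasurable (f i) μ := fun i => (hlaw i.1 i.2).aemeasurable.const_mul _
  let S : Finset ((V × ℕ) × ℕ) := (Finset.range n).image (Prod.mk q)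
  -- The shift `k + 1` leaves out the isolated waiting time `τ p 0`.
  let S' : Finset ((V × ℕ) × ℕ) := (Finset.range m).image fun k => (p, k + 1)
  have hdisj : Disjoint S S' := by
    rw [Finset.disjoint_left]
    rintro i hi hi'
    obtain ⟨a, -, rfl⟩ := Finset.mem_image.1 hi
    obtain ⟨b, -, hb⟩ := Finset.mem_image.1 hi'
    exact hpq (congrArg Prod.fst hb)
  have hnot : ((p, 0) : (V × ℕ) × ℕ) ∉ S ∪ S' := by
    simp [S, S', hpq.symm]
  have hind := hf.indepFun_finsetSum_of_notMem₀ hfm hnot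
  have hsum : ∀ ω, (∑ i ∈ S ∪ S', f i) ω
      = (∑ k ∈ Finset.range n, τ q k ω) - ∑ k ∈ Finset.range m, τ p (k + 1) ω := by
    intro ω
    rw [Finset.sum_apply, Finset.sum_union hdisj, Finset.sum_image (by simp),
      Finset.sum_image (by simp), sub_eq_add_neg, ← Finset.sum_neg_distrib]
    congr 1
    · exact Finset.sum_congr rfl fun k _ => by simp [f, c]
    · exact Finset.sum_congr rfl fun k _ => by simp [f, c, hpq]
  have hind' : IndepFun (∑ i ∈ S ∪ S', f i) (τ p 0) μ := by
    have := hind.comp measurable_id (measurable_neg (G := ℝ))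
    refine this.congr (ae_of_all _ fun ω => rfl) (ae_of_all _ fun ω => ?_)
    simp [f, hc]
  filter_upwards [ae_ne_of_indepFun (hlaw p 0).aemeasurable
    (Finset.aemeasurable_sum _ fun i _ => hfm i) hind'
    fun x => by rw [(hlaw p 0).map_eq]; exact expMeasure_one_singleton x] with ω hω heq
  refine hω ?_
  rw [hsum ω]
  simp only [ringTime, Finset.sum_range_succ' _ m] at heq
  linarith

lemma IsDriving.ae_isRegular [Countable V] [MeasurableSpace V] [DiscreteMeasurableSpace V]
    [IsProbabilityMeasure μ] {G : SimpleGraph V} {P : V → PMF V}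
    (hP : ∀ x y, P x y ≠ 0 → x = y ∨ G.Adj x y) {τ : V × ℕ → ℕ → Ω → ℝ}
    {ξ : V × ℕ → ℕ → V → Ω → V} (h : IsDriving P μ τ ξ) :
    ∀ᵐ ω ∂μ, IsRegular G (fun p k => τ p k ω) (fun p k x => ξ p k x ω) := by
  have h1 : ∀ᵐ ω ∂μ, ∀ p k, 0 < τ p k ω :=
    ae_all_iff.2 fun p => ae_all_iff.2 fun k => ae_pos_of_hasLaw_exp (h.law_wait p k)
  have h2 : ∀ᵐ ω ∂μ, ∀ p, Tendsto (ringTime (fun p k => τ p k ω) p) atTop atTop :=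
    ae_all_iff.2 fun p => ae_tendsto_sum_exp (h.law_wait p)
      (h.indep_wait.precomp (g := Prod.mk p) (Prod.mk_right_injective p))
  have h3 : ∀ᵐ ω ∂μ, ∀ p q, p ≠ q → ∀ m n, ringTime (fun p k => τ p k ω) p (m + 1)
      ≠ ringTime (fun p k => τ p k ω) q (n + 1) := by
    simp only [ae_all_iff]
    exact fun p q hpq m n => ae_ringTime_ne h.law_wait h.indep_wait hpq m (n + 1)
  have h4 : ∀ᵐ ω ∂μ, ∀ p k x, x = ξ p k x ω ∨ G.Adj x (ξ p k x ω) := by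
    simp only [ae_all_iff]
    intro p k x
    rw [(h.law_jump p k x).ae_iff (p := fun y => x = y ∨ G.Adj x y) (Measurable.of_discrete),
      ae_iff, PMF.toMeasure_apply_eq_zero_iff _ (MeasurableSet.of_discrete), Set.disjoint_left]
    exact fun y hy hn => hn (hP x y ((P x).mem_support_iff y |>.1 hy))
  filter_upwards [h1, h2, h3, h4] with ω a b c d
  exact ⟨a, b, c, d⟩

/-! ### Passage to the infinite system -/

/-- The histories in which every vertex of `F` is occupied at some rational time. -/
def coverEvent (F : Finset V) (T : ℝ) : Set (F → Set.Icc (0 : ℝ) T → ℕ∞) :=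
  {u | ∀ x, ∃ r : ℚ, ∃ hr : (r : ℝ) ∈ Set.Icc 0 T, u x ⟨r, hr⟩ ≠ 0}

/-- Rational times make the event a countable combination of coordinate events; right-continuity
ensures that no visit is missed. -/
lemma measurableSet_coverEvent (F : Finset V) (T : ℝ) : MeasurableSet (coverEvent F T) := by
  have : coverEvent F T = ⋂ x, ⋃ r : ℚ, ⋃ hr : (r : ℝ) ∈ Set.Icc 0 T,
      (fun u : F → Set.Icc (0 : ℝ) T → ℕ∞ => u x ⟨r, hr⟩) ⁻¹' {0}ᶜ := by
    ext u
    simp [coverEvent]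
  rw [this]
  refine MeasurableSet.iInter fun x => MeasurableSet.iUnion fun r => MeasurableSet.iUnion fun hr =>
    ?_
  exact ((measurable_pi_apply _).comp (measurable_pi_apply x)) (measurableSet_singleton 0).compl

lemma occupation_ne_zero {η : V → ℕ} {X : V × ℕ → ℝ → V} {x : V} {t : ℝ} :
    occupation η X x t ≠ 0 ↔ ∃ p ∈ particles η, X p t = x := by
  rw [occupation, Set.encard_ne_zero]
  rfl

lemma subset_visited_of_history_mem {η : V → ℕ} {X : V × ℕ → ℝ → V} {F : Finset V} {T : ℝ}
    (h : history η X F T ∈ coverEvent F T) : (F : Set V) ⊆ visited η X := by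
  intro x hx
  obtain ⟨r, hr, hne⟩ := h ⟨x, hx⟩
  obtain ⟨p, hp, hpx⟩ := occupation_ne_zero.1 hne
  exact ⟨p, hp, r, hr.1, hpx⟩

lemma IsPath.exists_history_mem {G : SimpleGraph V} {η : V → ℕ} {τ : V × ℕ → ℕ → ℝ}
    {ξ : V × ℕ → ℕ → V → V} {X : V × ℕ → ℝ → V} (hX : IsPath η τ ξ X) (h : IsRegular G τ ξ)
    {F : Finset V} (hF : (F : Set V) ⊆ visited η X) :
    ∃ N : ℕ, history η X F N ∈ coverEvent F (N : ℝ) := by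
  choose r hr0 hr using fun x : F => hX.exists_rat_occupied h (hF x.2)
  obtain ⟨M, hM⟩ := (Set.finite_range fun x : F => (r x : ℝ)).bddAbove
  obtain ⟨N, hN⟩ := exists_nat_ge M
  exact ⟨N, fun x => ⟨r x, ⟨hr0 x, (hM ⟨x, rfl⟩).trans hN⟩, occupation_ne_zero.2 (hr x)⟩⟩

lemma particles_indicator_finite (η : V → ℕ) (A : Finset V) :
    (particles ((A : Set V).indicator η)).Finite := by
  refine (mem_particles_finite_of_finite η A.finite_toSet).subset ?_
  rintro ⟨x, i⟩ hi
  by_cases hx : x ∈ (A : Set V)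
  · simp only [particles, Set.mem_ofPred_eq, Set.indicator_of_mem hx] at hi
    exact ⟨hi, hx⟩
  · simp [particles, Set.indicator_of_notMem hx] at hi

theorem ae_encard_component_le [Countable V] [MeasurableSpace V] [DiscreteMeasurableSpace V]
    [IsProbabilityMeasure μ] {G : SimpleGraph V} (o : V) {η : V → ℕ} {P : V → PMF V}
    (hP : ∀ x y, P x y ≠ 0 → x = y ∨ G.Adj x y) {τ : V × ℕ → ℕ → Ω → ℝ}
    {ξ : V × ℕ → ℕ → V → Ω → V} (hdrive : IsDriving P μ τ ξ)
    {X : V × ℕ → ℝ → Ω → V} (hX : IsProcess μ τ ξ η X)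
    (happrox : FinitelyApproximable μ τ ξ η X) :
    ∀ᵐ ω ∂μ, (component G (visited η (fun p t => X p t ω)) o).encard ≤ criticalSize G η o := by
  obtain ⟨A, Y, -, -, hY, hlim⟩ := happrox
  have hreg := hdrive.ae_isRegular hP
  have hnull : ∀ F : Finset V, ¬ (component G (F : Set V) o).encard ≤ criticalSize G η o →
      ∀ N : ℕ, ∀ᵐ ω ∂μ, history η (fun p t => X p t ω) F N ∉ coverEvent F (N : ℝ) := by
    intro F hF N
    have hm : ∀ m, μ {ω | history ((A m : Set V).indicator η) (fun p t => Y m p t ω) F N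
        ∈ coverEvent F (N : ℝ)} = 0 := by
      intro m
      refine measure_eq_zero_iff_ae_notMem.2 ?_
      filter_upwards [hreg, (hY m).path] with ω hr hp hmem
      refine hF ?_
      refine (Set.encard_le_encard (component_mono (subset_visited_of_history_mem hmem) o)).trans
        ((hp.encard_component_le hr (particles_indicator_finite η (A m)) o).trans ?_)
      -- Restricting `η` to `A m` can only lower the critical size.
      exact criticalSize_mono (fun x => Set.indicator_le_self' (fun _ _ => Nat.zero_le _) x) o
    have := hlim F N _ (measurableSet_coverEvent F N)
    simp only [hm] at this
    exact measure_eq_zero_iff_ae_notMem.1 (tendsto_nhds_unique this tendsto_const_nhds)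
  have hnull' : ∀ᵐ ω ∂μ, ∀ F : Finset V,
      ¬ (component G (F : Set V) o).encard ≤ criticalSize G η o →
      ∀ N : ℕ, history η (fun p t => X p t ω) F N ∉ coverEvent F (N : ℝ) := by
    simp only [ae_all_iff]
    exact hnull
  filter_upwards [hreg, hX.path, hnull'] with ω hr hp hn
  refine encard_component_le_of_forall_finset fun F hF => ?_
  by_contra hlt
  obtain ⟨N, hN⟩ := hp.exists_history_mem hr hF
  exact hn F hlt N hN

end Probability

end ARW

theorem mainTheorem5 {V Ω : Type*} [Countable V] [MeasurableSpace V] [DiscreteMeasurableSpace V]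
    [MeasurableSpace Ω] (μ : Measure Ω) [IsProbabilityMeasure μ]
    (G : SimpleGraph V) (o : V) (η : V → ℕ) (P : V → PMF V)
    (hP : ∀ x y, P x y ≠ 0 → x = y ∨ G.Adj x y)
    (τ : V × ℕ → ℕ → Ω → ℝ) (ξ : V × ℕ → ℕ → V → Ω → V) (hdrive : ARW.IsDriving P μ τ ξ)
    (X : V × ℕ → ℝ → Ω → V) (hX : ARW.IsProcess μ τ ξ η X)
    (happrox : ARW.FinitelyApproximable μ τ ξ η X) :
    (∀ᵐ ω ∂μ, (ARW.component G (ARW.visited η (fun p t => X p t ω)) o).encard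
        ≤ ARW.criticalSize G η o) ∧
    (ARW.criticalSize G η o < ⊤ →
      ∀ᵐ ω ∂μ, {p ∈ ARW.particles η | ∃ t, 0 ≤ t ∧ X p t ω = o}.Finite) := by
  have hcomp := ARW.ae_encard_component_le o hP hdrive hX happrox
  refine ⟨hcomp, fun htop => ?_⟩
  filter_upwards [hcomp, hdrive.ae_isRegular hP, hX.path] with ω hle hr hp
  have hfin := Set.encard_ne_top_iff.1 (ne_top_of_le_ne_top htop.ne hle)
  refine (ARW.mem_particles_finite_of_finite η hfin).subset ?_
  rintro p ⟨hpη, t, ht, hpt⟩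
  -- A visitor of `o` must have started in the component of `o`, which is finite and so holds
  -- finitely many particles initially.
  refine ⟨hpη, (hp.mem_component_iff hr hpη ht o).1 ?_⟩
  have ho : o ∈ ARW.visited η (fun p t => X p t ω) := ⟨p, hpη, t, ht, hpt⟩
  simp only [hpt]
  exact ⟨ho, ho, .rfl⟩
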